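/- Proposition 3.30. Let $\mathcal H$ be a separable, infinite-dimensional complex Hilbert space. A bounded operator $J$ on $\mathcal H$ is called a symmetry if $J = J^* = J^{-1}$, and $\mathrm{Sym}_3(\mathcal H)$ denotes the set of all products $J_1J_2J_3$ of three symmetries $J_1, J_2, J_3$ on $\mathcal H$. Let $\mathbb T = \{z \in \mathbb C : |z| = 1\}$ and $$E = \{\alpha \in \mathbb C : \alpha \neq 1 \text{ and } \alpha^p = 1 \text{ for some prime number } p \geq 3\}.$$ Suppose that $K \subseteq \mathbb T$ is nonempty and compact, that $K = -K := \{-z : z \in K\}$, and that $K \cap E$ is dense in $K$. Then there exists $V \in \mathrm{Sym}_3(\mathcal H)$ whose spectrum is $\sigma(V) = K$. -/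

import Mathlib

open scoped Pointwise

/-- A bounded operator `J` on a complex Hilbert space is a symmetry if `J = J* = J⁻¹`. -/
def IsHilbertSymmetry {H : Type*} [NormedAddCommGroup H] [InnerProductSpace ℂ H] [CompleteSpace H]
    (J : H →L[ℂ] H) : Prop :=
  ContinuousLinearMap.adjoint J = J ∧ J * J = 1

/-- `SymProducts k H` is the set of operators `J₁ J₂ ⋯ J_k` on `H`, each `J_j` a symmetry. -/
def SymProducts (k : ℕ) (H : Type*) [NormedAddCommGroup H] [InnerProductSpace ℂ H]
    [CompleteSpace H] : Set (H →L[ℂ] H) :=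
  {V | ∃ J : Fin k → (H →L[ℂ] H), (∀ j, IsHilbertSymmetry (J j)) ∧ V = (List.ofFn J).prod}

/-- The complex numbers `α ≠ 1` with `α ^ p = 1` for some prime `p ≥ 3`. -/
def oddPrimeRootsOfUnity : Set ℂ :=
  {α | α ≠ 1 ∧ ∃ p : ℕ, p.Prime ∧ 3 ≤ p ∧ α ^ p = 1}

/-! Take `a n` dense in `K` and a basis `b (k, n)`, `k ∈ ℤ`. Three weighted reflections of `ℤ`,
symmetries by `HilbertBasis.exists_symmetry`, multiply to `V (b (k, n)) = a n • b (-k, n)`: a flip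
on each block, scaled by `a n`. Then `V ^ 2` is diagonal with entries `a n ^ 2`, so `σ(V) ⊆ K ∪ -K =
K`, while each `a n` is an eigenvalue and `σ(V)` is closed. -/

theorem HilbertBasis.clm_ext {ι H : Type*} [NormedAddCommGroup H] [InnerProductSpace ℂ H]
    (b : HilbertBasis ι ℂ H) {S T : H →L[ℂ] H} (h : ∀ i, S (b i) = T (b i)) : S = T := by
  have hd : Dense (Submodule.span ℂ (Set.range b) : Set H) :=
    Submodule.dense_iff_topologicalClosure_eq_top.2 b.dense_span
  refine ContinuousLinearMap.ext_on hd ?_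
  rintro _ ⟨i, rfl⟩
  exact h i

/-- Multiplication of the coordinates of an `ℓ²` sequence by a bounded sequence. -/
theorem exists_lp_multiplier {ι : Type*} (m : ι → ℂ) {C : ℝ} (hm : ∀ i, ‖m i‖ ≤ C) :
    ∃ T : lp (fun _ : ι => ℂ) 2 →L[ℂ] lp (fun _ : ι => ℂ) 2, ∀ f i, T f i = m i * f i := by
  have hle (f : lp (fun _ : ι => ℂ) 2) (i : ι) : ‖m i * f i‖ ≤ ‖((C : ℂ) • f) i‖ := by
    rw [norm_mul, lp.coeFn_smul, Pi.smul_apply, norm_smul, Complex.norm_real]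
    exact mul_le_mul_of_nonneg_right ((hm i).trans (le_abs_self C)) (norm_nonneg _)
  have hmem (f : lp (fun _ : ι => ℂ) 2) : Memℓp (fun i => m i * f i) 2 :=
    Memℓp.mono' (lp.memℓp ((C : ℂ) • f)) (hle f)
  let L : lp (fun _ : ι => ℂ) 2 →ₗ[ℂ] lp (fun _ : ι => ℂ) 2 :=
    { toFun := fun f => ⟨fun i => m i * f i, hmem f⟩
      map_add' := fun f g => by ext i; exact mul_add _ _ _
      map_smul' := fun c f => by ext i; exact mul_left_comm _ _ _ }
  refine ⟨L.mkContinuous ‖(C : ℂ)‖ fun f => ?_, fun f i => rfl⟩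
  rw [← norm_smul]
  exact lp.norm_mono two_ne_zero (hle f)

section

variable {ι H : Type*} [NormedAddCommGroup H] [InnerProductSpace ℂ H]

theorem HilbertBasis.exists_diagonal (b : HilbertBasis ι ℂ H) (m : ι → ℂ) {C : ℝ}
    (hm : ∀ i, ‖m i‖ ≤ C) : ∃ T : H →L[ℂ] H, ∀ i, T (b i) = m i • b i := by
  classical
  obtain ⟨T, hT⟩ := exists_lp_multiplier m hm
  refine ⟨b.repr.symm.toContinuousLinearEquiv.toContinuousLinearMap ∘L T ∘L
    b.repr.toContinuousLinearEquiv.toContinuousLinearMap, fun i => ?_⟩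
  have h : T (lp.single 2 i (1 : ℂ)) = m i • lp.single 2 i (1 : ℂ) := by
    ext j
    rw [hT, lp.coeFn_smul, Pi.smul_apply, smul_eq_mul]
    by_cases hj : j = i
    · subst hj; simp
    · simp [lp.single_apply, hj]
  change b.repr.symm (T (b.repr (b i))) = _
  rw [b.repr_self, h, map_smul, b.repr_symm_single]

/-- Off `s`, the entries `(z - d i)⁻¹` are bounded by the inverse radius of a ball around `z`
missing `s`, so they define a bounded diagonal inverse. -/
theorem HilbertBasis.spectrum_subset_of_diagonal (b : HilbertBasis ι ℂ H) {D : H →L[ℂ] H}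
    {d : ι → ℂ} (hD : ∀ i, D (b i) = d i • b i) {s : Set ℂ} (hs : IsClosed s)
    (hd : ∀ i, d i ∈ s) : spectrum ℂ D ⊆ s := by
  intro z hz
  by_contra hzs
  obtain ⟨ε, hε, hball⟩ := Metric.isOpen_iff.1 hs.isOpen_compl z hzs
  have hdist (i : ι) : ε ≤ ‖z - d i‖ := by
    by_contra! h
    exact hball (by rwa [Metric.mem_ball, dist_comm, dist_eq_norm]) (hd i)
  have hne (i : ι) : z - d i ≠ 0 := norm_pos_iff.1 (hε.trans_le (hdist i))
  obtain ⟨T, hT⟩ := b.exists_diagonal (fun i => (z - d i)⁻¹) (C := ε⁻¹) fun i => by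
    rw [norm_inv]
    exact inv_anti₀ hε (hdist i)
  refine hz ⟨⟨algebraMap ℂ _ z - D, T, ?_, ?_⟩, rfl⟩ <;> refine b.clm_ext fun i => ?_
  · simp [hT, hD, Algebra.algebraMap_eq_smul_one, smul_smul, ← sub_smul, hne]
  · simp [hT, hD, Algebra.algebraMap_eq_smul_one, smul_smul, ← sub_smul, hne]

theorem mem_spectrum_of_apply_eq_smul {T : H →L[ℂ] H} {x : H} {z : ℂ} (hx : x ≠ 0)
    (h : T x = z • x) : z ∈ spectrum ℂ T := by
  rintro ⟨u, hu⟩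
  have hux : (u : H →L[ℂ] H) x = 0 := by
    simp [hu, h, Algebra.algebraMap_eq_smul_one]
  apply hx
  calc x = ((↑u⁻¹ : H →L[ℂ] H) * ↑u) x := by simp
    _ = (↑u⁻¹ : H →L[ℂ] H) ((u : H →L[ℂ] H) x) := rfl
    _ = 0 := by rw [hux, map_zero]

/-- Orthonormal vectors lie `√2` apart, so balls of radius `1 / 2` around them are disjoint. -/
theorem Orthonormal.countable [TopologicalSpace.SeparableSpace H] {v : ι → H}
    (hv : Orthonormal ℂ v) : Countable ι := by
  refine Pairwise.countable_of_isOpen_disjoint (s := fun i => Metric.ball (v i) (1 / 2)) ?_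
    (fun i => Metric.isOpen_ball) fun i => ⟨v i, Metric.mem_ball_self (by norm_num)⟩
  intro i j hij
  refine Metric.ball_disjoint_ball ?_
  have h : ‖v i - v j‖ ^ 2 = 2 := by
    rw [@norm_sub_sq ℂ, hv.2 hij, hv.1, hv.1]
    norm_num
  rw [dist_eq_norm]
  nlinarith [norm_nonneg (v i - v j)]

variable [CompleteSpace H]

/-- A weighted permutation of a Hilbert basis along an involution, with unimodular weights that
the involution conjugates, is a symmetry. -/
theorem HilbertBasis.exists_symmetry (b : HilbertBasis ι ℂ H) (σ : ι → ι)
    (hσ : Function.Involutive σ) (c : ι → ℂ) (hc : ∀ i, ‖c i‖ = 1)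
    (hcσ : ∀ i, c (σ i) = (c i)⁻¹) :
    ∃ T : H →L[ℂ] H, IsHilbertSymmetry T ∧ ∀ i, T (b i) = c i • b (σ i) := by
  classical
  have hc0 (i : ι) : c i ≠ 0 := norm_ne_zero_iff.1 (by simp [hc])
  have hv : Orthonormal ℂ fun i => c i • b (σ i) :=
    ⟨fun i => by simp [norm_smul, hc, b.orthonormal.1], fun i j hij => by
      simp only [inner_smul_left, inner_smul_right]
      rw [b.orthonormal.2 (hσ.injective.ne hij), mul_zero, mul_zero]⟩
  have hsp : ⊤ ≤ (Submodule.span ℂ (Set.range fun i => c i • b (σ i))).topologicalClosure := by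
    rw [← b.dense_span]
    refine Submodule.topologicalClosure_mono (Submodule.span_le.2 ?_)
    rintro _ ⟨i, rfl⟩
    have h := Submodule.smul_mem (Submodule.span ℂ (Set.range fun i => c i • b (σ i)))
      (c i) (Submodule.subset_span ⟨σ i, rfl⟩)
    simpa [hσ i, hcσ, smul_smul, hc0] using h
  let e : H ≃ₗᵢ[ℂ] H := b.repr.trans (HilbertBasis.mk hv hsp).repr.symm
  have he (i : ι) : e (b i) = c i • b (σ i) := by
    change (HilbertBasis.mk hv hsp).repr.symm (b.repr (b i)) = _
    rw [b.repr_self, HilbertBasis.repr_symm_single, HilbertBasis.coe_mk]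
  let T : H →L[ℂ] H := e.toContinuousLinearEquiv.toContinuousLinearMap
  have hT (x : H) : T x = e x := rfl
  have hTT : T * T = 1 := b.clm_ext fun i => by
    simp [hT, he, hσ i, hcσ, smul_smul, hc0]
  refine ⟨T, ⟨?_, hTT⟩, he⟩
  have hadj : ContinuousLinearMap.adjoint T * T = 1 := by
    ext x
    refine ext_inner_left ℂ fun y => ?_
    simp [ContinuousLinearMap.adjoint_inner_right, hT]
  calc ContinuousLinearMap.adjoint T = ContinuousLinearMap.adjoint T * (T * T) := by
        rw [hTT, mul_one]
    _ = T := by rw [← mul_assoc, hadj, one_mul]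

/-- A separable infinite-dimensional Hilbert space has a Hilbert basis indexed by any countably
infinite type. -/
theorem exists_hilbertBasis_of_denumerable [TopologicalSpace.SeparableSpace H]
    (hH : ¬ FiniteDimensional ℂ H) (κ : Type*) [Countable κ] [Infinite κ] :
    Nonempty (HilbertBasis κ ℂ H) := by
  obtain ⟨w, b, -⟩ := exists_hilbertBasis ℂ H
  have : Countable w := b.orthonormal.countable
  have : Infinite w := by
    by_contra hfin
    rw [not_infinite_iff_finite] at hfin
    have := Fintype.ofFinite w
    exact hH b.toOrthonormalBasis.toBasis.finiteDimensional_of_finite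
  obtain ⟨e⟩ : Nonempty (κ ≃ w) := nonempty_equiv_of_countable
  refine ⟨HilbertBasis.mk (b.orthonormal.comp e e.injective) ?_⟩
  rw [e.surjective.range_comp b, b.dense_span]

end

theorem proposition3p30 {H : Type*} [NormedAddCommGroup H] [InnerProductSpace ℂ H]
    [CompleteSpace H] [TopologicalSpace.SeparableSpace H] (hH : ¬ FiniteDimensional ℂ H)
    (K : Set ℂ) (hne : K.Nonempty) (hcpt : IsCompact K) (hKT : K ⊆ Metric.sphere (0 : ℂ) 1)
    (hsymm : K = -K) (hdense : K ⊆ closure (K ∩ oddPrimeRootsOfUnity)) :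
    ∃ V ∈ SymProducts 3 H, spectrum ℂ V = K := by
  have : Nonempty K := hne.to_subtype
  let a (n : ℕ) : ℂ := TopologicalSpace.denseSeq K n
  have haK (n : ℕ) : a n ∈ K := (TopologicalSpace.denseSeq K n).2
  have ha1 (n : ℕ) : ‖a n‖ = 1 := mem_sphere_zero_iff_norm.1 (hKT (haK n))
  have ha0 (n : ℕ) : a n ≠ 0 := norm_ne_zero_iff.1 (by simp [ha1])
  have haz (n : ℕ) (k : ℤ) : ‖a n ^ k‖ = 1 := by rw [norm_zpow, ha1, one_zpow]
  obtain ⟨b⟩ := exists_hilbertBasis_of_denumerable hH (ℤ × ℕ)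
  -- The exponents `2k` and `-2k - 1` change sign under `k ↦ -k` and `k ↦ -k - 1` respectively, as a
  -- symmetry requires. `S * J` sends `k` to `k - 1` with weight `a ^ (2k)`; `J'` then contributes
  -- `a ^ (-2k + 1)`, leaving a single factor `a`.
  obtain ⟨J, hJ, hJb⟩ := b.exists_symmetry (fun i => (-i.1, i.2)) (fun i => by simp)
    (fun i => a i.2 ^ (2 * i.1)) (fun i => haz _ _) fun i => by
      rw [← zpow_neg, mul_neg]
  obtain ⟨S, hS, hSb⟩ := b.exists_symmetry (fun i => (-i.1 - 1, i.2)) (fun i => by simp)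
    (fun _ => 1) (fun _ => by simp) fun i => by simp
  obtain ⟨J', hJ', hJb'⟩ := b.exists_symmetry (fun i => (-i.1 - 1, i.2)) (fun i => by simp)
    (fun i => a i.2 ^ (-2 * i.1 - 1)) (fun i => haz _ _) fun i => by
      rw [← zpow_neg]
      congr 1
      ring
  have hV (k : ℤ) (n : ℕ) : (J' * (S * J)) (b (k, n)) = a n • b (-k, n) := by
    simp only [mul_apply_eq_comp, hJb, hSb, hJb', map_smul, smul_smul, mul_one]
    rw [← zpow_add₀ (ha0 n), show 2 * k + (-2 * (- -k - 1) - 1) = 1 by ring, zpow_one,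
      show -(- -k - 1) - 1 = -k by ring]
  refine ⟨J' * (S * J), ⟨![J', S, J], fun j => ?_, by simp [List.ofFn_succ]⟩, ?_⟩
  · fin_cases j
    exacts [hJ', hS, hJ]
  apply Set.Subset.antisymm
  · intro z hz
    have hVV (i : ℤ × ℕ) : ((J' * (S * J)) ^ 2) (b i) = (a i.2 ^ 2) • b i := by
      obtain ⟨k, n⟩ := i
      rw [pow_two, mul_apply_eq_comp, hV, map_smul, hV, smul_smul, neg_neg, pow_two]
    obtain ⟨w, hw, hwz⟩ := b.spectrum_subset_of_diagonal hVV
      (hcpt.image (continuous_pow 2)).isClosed (fun i => ⟨a i.2, haK _, rfl⟩)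
      (spectrum.pow_mem_pow _ 2 hz)
    rcases sq_eq_sq_iff_eq_or_eq_neg.1 hwz with rfl | rfl
    · exact hw
    · rw [hsymm]
      exact hw
  · have hcl : K ⊆ closure (Set.range a) := by
      have h := (TopologicalSpace.denseRange_denseSeq K).closure_range
      intro z hz
      have hz' : (⟨z, hz⟩ : K) ∈ closure (Set.range (TopologicalSpace.denseSeq K)) := by
        rw [h]; trivial
      rw [closure_subtype, ← Set.range_comp] at hz'
      exact hz'
    refine hcl.trans (closure_minimal ?_ (spectrum.isClosed _))
    rintro _ ⟨n, rfl⟩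
    -- The index `0` is the fixed point of `k ↦ -k`.
    exact mem_spectrum_of_apply_eq_smul (x := b (0, n)) (b.orthonormal.ne_zero _) (by
      rw [hV, neg_zero])
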